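/- For a positive integer $n$, take three copies $A,B,C$ of the set $\{1,\dots,n\}$, and let $F_D(n)$ be the minimum of $$\sum_{(a,b,c)} abc$$ over all partitions of these $3n$ numbers into $n$ triples $(a,b,c)$ with $a\in A$, $b\in B$, $c\in C$. Let $C_P$ be the optimal value of the continuous (primal) transportation problem with cost function $xyz$ and uniform marginals, $$C_P=\min_{\mu}\int_{[0,1]^3}xyz\,d\mu(x,y,z),$$ where $\mu$ ranges over all positive measures on $[0,1]^3$ whose projections onto the three coordinate axes are all equal to the Lebesgue measure on $[0,1]$. Then this minimum is attained, and $$F_D(n)\sim C_P\,n^4\qquad (n\to\infty).$$ -/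

import Mathlib

open MeasureTheory Filter Asymptotics

/-- A partition of three copies `A`, `B`, `C` of `{1, …, n}` into triples `(a, b, c)` with
`a ∈ A`, `b ∈ B`, `c ∈ C`: a finite set of triples in which every element of each of the three
copies occurs, in its own coordinate, in exactly one triple (so there are `n` triples). -/
def IsTriplePartition (n : ℕ) (T : Finset (ℕ × ℕ × ℕ)) : Prop :=
  Set.BijOn (fun t : ℕ × ℕ × ℕ => t.1) (T : Set (ℕ × ℕ × ℕ)) (Set.Icc 1 n) ∧
  Set.BijOn (fun t : ℕ × ℕ × ℕ => t.2.1) (T : Set (ℕ × ℕ × ℕ)) (Set.Icc 1 n) ∧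
  Set.BijOn (fun t : ℕ × ℕ × ℕ => t.2.2) (T : Set (ℕ × ℕ × ℕ)) (Set.Icc 1 n)

/-- The sum `∑ abc` over the triples of `T`. -/
def tripleSum (T : Finset (ℕ × ℕ × ℕ)) : ℕ :=
  ∑ t ∈ T, t.1 * t.2.1 * t.2.2

/-- The set of values of `∑ abc` over all partitions into triples. -/
def tripleSums (n : ℕ) : Set ℕ :=
  {s | ∃ T : Finset (ℕ × ℕ × ℕ), IsTriplePartition n T ∧ tripleSum T = s}

/-- `F_D(n)`: the minimum of `∑ abc` over all partitions into triples. -/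
noncomputable def discreteMin (n : ℕ) : ℕ :=
  sInf (tripleSums n)

/-- Partitions into triples exist, so `discreteMin n` is an attained minimum. -/
theorem isLeast_discreteMin (n : ℕ) : IsLeast (tripleSums n) (discreteMin n) := by
  have hne : (tripleSums n).Nonempty := by
    refine ⟨_, (Finset.Icc 1 n).image (fun i => (i, i, i)), ⟨?_, ?_, ?_⟩, rfl⟩ <;>
    · refine ⟨?_, ?_, ?_⟩
      · rintro ⟨a, b, c⟩ h
        simp at h ⊢
        grind
      · rintro ⟨a, b, c⟩ h ⟨a', b', c'⟩ h' e
        simp at h h' e ⊢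
        grind
      · intro i hi
        exact ⟨(i, i, i), by simpa using hi, rfl⟩
  exact ⟨Nat.sInf_mem hne, fun s hs => Nat.sInf_le hs⟩

/-- `Π(μ₁, μ₂, μ₃)`: joint (positive) measures on the product whose marginals are the `μᵢ`. -/
def jointMeasures {X Y Z : Type*} [MeasurableSpace X] [MeasurableSpace Y] [MeasurableSpace Z]
    (μ₁ : Measure X) (μ₂ : Measure Y) (μ₃ : Measure Z) : Set (Measure (X × Y × Z)) :=
  {μ | μ.map (fun p => p.1) = μ₁ ∧ μ.map (fun p => p.2.1) = μ₂ ∧ μ.map (fun p => p.2.2) = μ₃}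

/-- The (3,1)-stochastic measures: measures on `[0,1]³` whose projections onto the three axes are
Lebesgue measure on `[0,1]`. -/
def stochasticMeasures : Set (Measure (unitInterval × unitInterval × unitInterval)) :=
  jointMeasures (volume : Measure unitInterval) (volume : Measure unitInterval)
    (volume : Measure unitInterval)

/-- The value `∫ xyz dμ` of the primal functional. -/
noncomputable def primalValue (μ : Measure (unitInterval × unitInterval × unitInterval)) : ℝ :=
  ∫ p, (p.1 : ℝ) * (p.2.1 : ℝ) * (p.2.2 : ℝ) ∂μ

/-- `C_P`: the optimal value of the primal problem with cost `xyz` and uniform marginals. -/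
noncomputable def primalOptimum : ℝ :=
  sInf (primalValue '' stochasticMeasures)

open scoped unitInterval ENNReal

/-! ### Attainment and positivity of the continuous optimum -/

/-! The quotient `F_D(n) / n^4` is squeezed towards `C_P`. Lower bound: for each triple `(a, b, c)`,
spread mass `1/n` along the diagonal of the cube of side `1/n` with top corner `(a, b, c)/n`. This
turns a partition into a stochastic measure of no larger normalised cost, so `C_P ≤ F_D(n) / n^4`
for every `n ≠ 0` (`primalOptimum_le_discreteMin`). Upper bound: cut the cube into cells of mesh
`1/m`, allot about `n μ(cell)` of `n` points to each cell, with `μ` optimal, and rank the points by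
each coordinate separately. The three rankings form a partition. Uniform marginals keep each rank
below about `n` times the upper edge of the cell, so the quotient is eventually at most `C_P + 8/m`
(`eventually_discreteMin_le`). An optimal `μ` exists by weak compactness, and `C_P > 0` turns the
limit into an asymptotic equivalence. -/

theorem isProbabilityMeasure_of_mem_stochasticMeasures {μ : Measure (I × I × I)}
    (hμ : μ ∈ stochasticMeasures) : IsProbabilityMeasure μ := by
  constructor
  have h := congrArg (fun ν : Measure I => ν Set.univ) hμ.1
  simpa [Measure.map_apply measurable_fst MeasurableSet.univ] using h

theorem volume_mem_stochasticMeasures :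
    (volume : Measure I).map (fun x => (x, x, x)) ∈ stochasticMeasures := by
  refine ⟨?_, ?_, ?_⟩ <;>
  · rw [Measure.map_map (by fun_prop) (by fun_prop)]
    exact Measure.map_id

theorem continuous_cost :
    Continuous fun p : I × I × I => (p.1 : ℝ) * (p.2.1 : ℝ) * (p.2.2 : ℝ) := by
  fun_prop

theorem integrable_of_continuous_of_compactSpace {X : Type*} [TopologicalSpace X] [CompactSpace X]
    [MeasurableSpace X] [OpensMeasurableSpace X] {μ : Measure X} [IsFiniteMeasure μ] {f : X → ℝ}
    (hf : Continuous f) : Integrable f μ :=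
  (BoundedContinuousFunction.mkOfCompact ⟨f, hf⟩).integrable μ

/-- Probability measures on a compact metric space are weakly compact, and pushforward along a
continuous map is weakly continuous, so each marginal condition is closed. -/
theorem isCompact_stochasticMeasures :
    IsCompact {μ : ProbabilityMeasure (I × I × I) |
      (μ : Measure (I × I × I)) ∈ stochasticMeasures} := by
  let vol : ProbabilityMeasure I := ⟨volume, inferInstance⟩
  have key (f : I × I × I → I) (hf : Continuous f) :
      IsClosed {μ : ProbabilityMeasure (I × I × I) |
        (μ : Measure (I × I × I)).map f = (volume : Measure I)} := by
    have h : IsClosed {μ : ProbabilityMeasure (I × I × I) |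
        μ.map hf.measurable.aemeasurable = vol} :=
      isClosed_eq (ProbabilityMeasure.continuous_map hf) continuous_const
    convert h using 3 with μ
    rw [← ProbabilityMeasure.toMeasure_injective.eq_iff]
    rfl
  exact ((key _ (by fun_prop)).inter
    ((key _ (by fun_prop)).inter (key _ (by fun_prop)))).isCompact

theorem isLeast_primalOptimum : IsLeast (primalValue '' stochasticMeasures) primalOptimum := by
  have hne : {μ : ProbabilityMeasure (I × I × I) |
      (μ : Measure (I × I × I)) ∈ stochasticMeasures}.Nonempty :=
    ⟨⟨_, isProbabilityMeasure_of_mem_stochasticMeasures volume_mem_stochasticMeasures⟩,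
      volume_mem_stochasticMeasures⟩
  obtain ⟨μ, hμ, hmin⟩ := isCompact_stochasticMeasures.exists_isMinOn hne
    (ProbabilityMeasure.continuous_integral_continuousMap
      (⟨_, continuous_cost⟩ : C(I × I × I, ℝ))).continuousOn
  have h : IsLeast (primalValue '' stochasticMeasures) (primalValue μ) := by
    refine ⟨⟨μ, hμ, rfl⟩, ?_⟩
    rintro _ ⟨ν, hν, rfl⟩
    have := isProbabilityMeasure_of_mem_stochasticMeasures hν
    exact hmin (show (⟨ν, this⟩ : ProbabilityMeasure (I × I × I)) ∈ _ from hν)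
  rw [primalOptimum, h.csInf_eq]
  exact h

/-- Lebesgue marginals have no atom at `0`, so the cost is positive almost everywhere. -/
theorem primalOptimum_pos : 0 < primalOptimum := by
  obtain ⟨μ, hμ, h⟩ := isLeast_primalOptimum.1
  have := isProbabilityMeasure_of_mem_stochasticMeasures hμ
  have key (f : I × I × I → I) (hf : Measurable f) (hm : μ.map f = volume) :
      ∀ᵐ p ∂μ, 0 < (f p : ℝ) := by
    have h0 : ∀ᵐ x : I, x ≠ 0 := by
      simp [ae_iff]
    rw [← hm] at h0
    filter_upwards [ae_of_ae_map hf.aemeasurable h0] with p hp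
    exact lt_of_le_of_ne (f p).2.1 fun e => hp (Subtype.ext e.symm)
  rw [← h, primalValue, integral_pos_iff_support_of_nonneg_ae]
  · refine pos_iff_ne_zero.2 fun h0 => ?_
    have h1 : ∀ᵐ p ∂μ, (p.1 : ℝ) * (p.2.1 : ℝ) * (p.2.2 : ℝ) = 0 := by
      rw [ae_iff]; exact h0
    have h2 : ∀ᵐ p ∂μ, False := by
      filter_upwards [h1, key _ (by fun_prop) hμ.1, key _ (by fun_prop) hμ.2.1,
        key _ (by fun_prop) hμ.2.2] with p hp h1 h2 h3
      exact (mul_pos (mul_pos h1 h2) h3).ne' hp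
    exact IsProbabilityMeasure.ne_zero μ (by simpa using h2)
  · exact Eventually.of_forall fun p => mul_nonneg (mul_nonneg p.1.2.1 p.2.1.2.1) p.2.2.2.1
  · exact integrable_of_continuous_of_compactSpace continuous_cost

/-! ### The lower bound: spreading a partition over the unit cube -/

/-- The affine map of `[0,1]` onto the `i`-th of the `n` intervals `[(i - 1) / n, i / n]`. -/
noncomputable def cellMap (n i : ℕ) (x : I) : I :=
  Set.projIcc 0 1 zero_le_one ((x : ℝ) / n + ((i : ℝ) - 1) / n)

theorem continuous_cellMap (n i : ℕ) : Continuous (cellMap n i) :=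
  continuous_projIcc.comp (by fun_prop)

theorem cellMap_le (n i : ℕ) (x : I) : (cellMap n i x : ℝ) ≤ i / n := by
  have h : (x : ℝ) / n + ((i : ℝ) - 1) / n ≤ i / n := by
    rw [← add_div]
    exact div_le_div_of_nonneg_right (by linarith [x.2.2]) n.cast_nonneg
  rw [cellMap, Set.coe_projIcc]
  exact max_le (by positivity) ((min_le_right _ _).trans h)

theorem integral_unitInterval_eq (f : ℝ → ℝ) :
    ∫ x : I, f x = ∫ x in (0 : ℝ)..1, f x := by
  rw [intervalIntegral.integral_of_le zero_le_one, ← integral_Icc_eq_integral_Ioc]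
  exact integral_subtype measurableSet_Icc f

theorem sum_integral_cellMap {n : ℕ} (hn : n ≠ 0) {f : I → ℝ} (hf : Continuous f) :
    ∑ i ∈ Finset.Icc 1 n, (n : ℝ)⁻¹ * ∫ x, f (cellMap n i x) = ∫ x, f x := by
  have hn' : (n : ℝ) ≠ 0 := by exact_mod_cast hn
  set F : ℝ → ℝ := Set.IccExtend (zero_le_one' ℝ) f
  have hFc : Continuous F := hf.Icc_extend'
  have e1 : ∫ x, f x = ∫ x in (0 : ℝ)..1, F x := by
    rw [← integral_unitInterval_eq]
    exact integral_congr_ae (Eventually.of_forall fun x => (Set.IccExtend_val _ f x).symm)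
  have e2 (i : ℕ) : (n : ℝ)⁻¹ * ∫ x, f (cellMap n (i + 1) x) =
      ∫ x in ((i : ℕ) : ℝ) / n..((i + 1 : ℕ) : ℝ) / n, F x := by
    have : ∫ x, f (cellMap n (i + 1) x) = ∫ x in (0 : ℝ)..1, F (x / n + (i : ℝ) / n) := by
      rw [← integral_unitInterval_eq (fun x => F (x / n + (i : ℝ) / n))]
      simp [F, cellMap, Set.IccExtend]
    rw [this, intervalIntegral.inv_mul_integral_comp_div_add]
    congr 1
    · simp
    · push_cast; ring
  have e3 : ∑ i ∈ Finset.Icc 1 n, (n : ℝ)⁻¹ * ∫ x, f (cellMap n i x) =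
      ∑ i ∈ Finset.range n, (n : ℝ)⁻¹ * ∫ x, f (cellMap n (i + 1) x) := by
    rw [Finset.range_eq_Ico, Finset.sum_Ico_add' (fun i => (n : ℝ)⁻¹ * ∫ x, f (cellMap n i x))]
    rfl
  rw [e3, e1, Finset.sum_congr rfl fun i _ => e2 i,
    intervalIntegral.sum_integral_adjacent_intervals fun k _ => hFc.intervalIntegrable _ _]
  simp [hn']

/-- The measure on the unit cube which gives mass `1 / n` to the diagonal of each of the cubes of
side `1 / n` picked out by the triples of `T`. -/
noncomputable def partitionMeasure (n : ℕ) (T : Finset (ℕ × ℕ × ℕ)) : Measure (I × I × I) :=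
  (n : ℝ≥0∞)⁻¹ • ∑ t ∈ T, (volume : Measure I).map
    (fun x => (cellMap n t.1 x, cellMap n t.2.1 x, cellMap n t.2.2 x))

theorem continuous_cellMap_triple (n : ℕ) (t : ℕ × ℕ × ℕ) :
    Continuous fun x => (cellMap n t.1 x, cellMap n t.2.1 x, cellMap n t.2.2 x) :=
  (continuous_cellMap n _).prodMk ((continuous_cellMap n _).prodMk (continuous_cellMap n _))

theorem isFiniteMeasure_partitionMeasure {n : ℕ} (hn : n ≠ 0) (T : Finset (ℕ × ℕ × ℕ)) :
    IsFiniteMeasure (partitionMeasure n T) := by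
  constructor
  simp only [partitionMeasure, Measure.smul_apply, Measure.finsetSum_apply, smul_eq_mul]
  refine ENNReal.mul_lt_top (by simp [pos_iff_ne_zero, hn])
    (ENNReal.sum_lt_top.2 fun t _ => measure_lt_top _ _)

theorem integral_partitionMeasure (n : ℕ) (T : Finset (ℕ × ℕ × ℕ)) {f : I × I × I → ℝ}
    (hf : Continuous f) : ∫ p, f p ∂(partitionMeasure n T) =
      ∑ t ∈ T, (n : ℝ)⁻¹ * ∫ x, f (cellMap n t.1 x, cellMap n t.2.1 x, cellMap n t.2.2 x) := by
  rw [partitionMeasure, integral_smul_measure, integral_finsetSum_measure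
    fun t _ => integrable_of_continuous_of_compactSpace hf, Finset.smul_sum]
  refine Finset.sum_congr rfl fun t _ => ?_
  rw [integral_map (continuous_cellMap_triple n t).aemeasurable hf.aestronglyMeasurable]
  simp

/-- Since `c` is a bijection, the pieces project onto each interval of length `1/n` exactly once and
tile `[0,1]`. Bounded continuous functions suffice to identify a finite measure. -/
theorem map_partitionMeasure {n : ℕ} (hn : n ≠ 0) {T : Finset (ℕ × ℕ × ℕ)}
    {c : ℕ × ℕ × ℕ → ℕ} (hc : Set.BijOn c (T : Set (ℕ × ℕ × ℕ)) (Set.Icc 1 n))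
    {π : I × I × I → I} (hπ : Continuous π)
    (hcπ : ∀ t x, π (cellMap n t.1 x, cellMap n t.2.1 x, cellMap n t.2.2 x) = cellMap n (c t) x) :
    (partitionMeasure n T).map π = volume := by
  have := isFiniteMeasure_partitionMeasure hn T
  refine ext_of_forall_integral_eq_of_IsFiniteMeasure fun f => ?_
  rw [integral_map hπ.aemeasurable f.continuous.aestronglyMeasurable,
    integral_partitionMeasure n T (f := fun p => f (π p)) (f.continuous.comp hπ), ← sum_integral_cellMap hn f.continuous]
  simp only [hcπ]
  refine Finset.sum_nbij c (fun t ht => ?_) hc.injOn ?_ fun _ _ => rfl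
  · simpa using hc.mapsTo ht
  · simpa using hc.surjOn

theorem partitionMeasure_mem_stochasticMeasures {n : ℕ} (hn : n ≠ 0) {T : Finset (ℕ × ℕ × ℕ)}
    (hT : IsTriplePartition n T) : partitionMeasure n T ∈ stochasticMeasures :=
  ⟨map_partitionMeasure hn hT.1 (by fun_prop) fun _ _ => rfl,
    map_partitionMeasure hn hT.2.1 (by fun_prop) fun _ _ => rfl,
    map_partitionMeasure hn hT.2.2 (by fun_prop) fun _ _ => rfl⟩

theorem primalValue_partitionMeasure_le {n : ℕ} (T : Finset (ℕ × ℕ × ℕ)) :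
    primalValue (partitionMeasure n T) ≤ tripleSum T / (n : ℝ) ^ 4 := by
  rw [primalValue, integral_partitionMeasure n T continuous_cost, tripleSum, Nat.cast_sum,
    Finset.sum_div]
  refine Finset.sum_le_sum fun t _ => ?_
  have h : ∫ x, (cellMap n t.1 x : ℝ) * (cellMap n t.2.1 x : ℝ) * (cellMap n t.2.2 x : ℝ) ≤
      ∫ _ : I, (t.1 / n * (t.2.1 / n) * (t.2.2 / n) : ℝ) := by
    refine integral_mono (integrable_of_continuous_of_compactSpace
      (continuous_cost.comp (continuous_cellMap_triple n t))) (integrable_const _) fun x => ?_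
    have := (cellMap n t.2.2 x).2.1
    have := (cellMap n t.2.1 x).2.1
    gcongr <;> exact cellMap_le _ _ _
  rw [integral_const, probReal_univ, one_smul] at h
  calc _ ≤ (n : ℝ)⁻¹ * (t.1 / n * (t.2.1 / n) * (t.2.2 / n) : ℝ) := by gcongr
    _ = _ := by push_cast; ring

theorem primalOptimum_le_discreteMin {n : ℕ} (hn : n ≠ 0) :
    primalOptimum ≤ discreteMin n / (n : ℝ) ^ 4 := by
  obtain ⟨T, hT, h⟩ := (isLeast_discreteMin n).1
  rw [← h]
  exact (isLeast_primalOptimum.2 ⟨_, partitionMeasure_mem_stochasticMeasures hn hT, rfl⟩).trans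
    (primalValue_partitionMeasure_le T)

/-! ### The upper bound: partitions from finite weights -/

/-- Sort by `x`, breaking ties somehow: every point ranked no later than `s` has value at most `x
s`. Ties only enlarge the count on the right. -/
theorem exists_perm_succ_le_card {n : ℕ} (x : Fin n → ℕ) :
    ∃ e : Equiv.Perm (Fin n), ∀ s, (e s : ℕ) + 1 ≤ Fintype.card {r // x r ≤ x s} := by
  refine ⟨(Tuple.sort x).symm, fun s => ?_⟩
  have h := Tuple.monotone_sort x
  rw [Fintype.card_subtype, ← Fin.card_Iic, ← Finset.card_map (Tuple.sort x).toEmbedding]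
  refine Finset.card_le_card fun r hr => ?_
  obtain ⟨j, hj, rfl⟩ := Finset.mem_map.1 hr
  simpa using h (Finset.mem_Iic.1 hj)

theorem discreteMin_le_sum_perm {n : ℕ} (e₁ e₂ e₃ : Equiv.Perm (Fin n)) :
    discreteMin n ≤ ∑ s, ((e₁ s : ℕ) + 1) * ((e₂ s : ℕ) + 1) * ((e₃ s : ℕ) + 1) := by
  have inj (e : Equiv.Perm (Fin n)) {s r : Fin n} (h : (e s : ℕ) + 1 = (e r : ℕ) + 1) : s = r :=
    e.injective (Fin.ext (Nat.succ_injective h))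
  let g (s : Fin n) : ℕ × ℕ × ℕ := ((e₁ s : ℕ) + 1, (e₂ s : ℕ) + 1, (e₃ s : ℕ) + 1)
  have hg : Function.Injective g := fun s r h => inj e₁ (Prod.ext_iff.1 h).1
  have bij (e : Equiv.Perm (Fin n)) (c : ℕ × ℕ × ℕ → ℕ) (hc : ∀ s, c (g s) = (e s : ℕ) + 1) :
      Set.BijOn c ((Finset.univ.image g : Finset (ℕ × ℕ × ℕ)) : Set (ℕ × ℕ × ℕ))
        (Set.Icc 1 n) := by
    simp only [Finset.coe_image, Finset.coe_univ, Set.image_univ]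
    refine ⟨?_, ?_, fun i hi => ?_⟩
    · rintro _ ⟨s, rfl⟩
      rw [hc]
      exact ⟨by omega, (e s).2⟩
    · rintro _ ⟨s, rfl⟩ _ ⟨r, rfl⟩ h
      rw [hc, hc] at h
      rw [inj e h]
    · have hi' : i - 1 < n := by have := hi.1; have := hi.2; omega
      refine ⟨_, ⟨e.symm ⟨i - 1, hi'⟩, rfl⟩, ?_⟩
      rw [hc]
      simpa using Nat.sub_add_cancel hi.1
  refine (isLeast_discreteMin n).2 ⟨Finset.univ.image g,
    ⟨bij e₁ _ fun _ => rfl, bij e₂ _ fun _ => rfl, bij e₃ _ fun _ => rfl⟩, ?_⟩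
  rw [tripleSum, Finset.sum_image hg.injOn]

theorem discreteMin_le_sum_card {n : ℕ} (x y z : Fin n → ℕ) :
    discreteMin n ≤ ∑ s, Fintype.card {r // x r ≤ x s} * Fintype.card {r // y r ≤ y s} *
      Fintype.card {r // z r ≤ z s} := by
  obtain ⟨e₁, h₁⟩ := exists_perm_succ_le_card x
  obtain ⟨e₂, h₂⟩ := exists_perm_succ_le_card y
  obtain ⟨e₃, h₃⟩ := exists_perm_succ_le_card z
  refine (discreteMin_le_sum_perm e₁ e₂ e₃).trans (Finset.sum_le_sum fun s _ => ?_)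
  gcongr
  exacts [h₁ s, h₂ s, h₃ s]

theorem exists_fun_card_fiber_eq {α : Type*} [Fintype α] [DecidableEq α] {n : ℕ} (k : α → ℕ)
    (hk : ∑ a, k a = n) : ∃ f : Fin n → α, ∀ a, Fintype.card {s // f s = a} = k a := by
  have e : Fin n ≃ Σ a, Fin (k a) := Fintype.equivOfCardEq (by simp [hk])
  refine ⟨fun s => (e s).1, fun a => ?_⟩
  rw [← Fintype.card_fin (k a)]
  exact Fintype.card_congr ((e.subtypeEquiv fun _ => Iff.rfl).trans
    (Equiv.sigmaSubtype (β := fun a => Fin (k a)) a))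

theorem exists_fun_card_fiber_le {α : Type*} [Fintype α] [DecidableEq α] {p : α → ℝ}
    (hp : ∀ a, 0 ≤ p a) (hsum : ∑ a, p a = 1) (n : ℕ) :
    ∃ f : Fin n → α, ∀ a, (Fintype.card {s // f s = a} : ℝ) ≤ n * p a + Fintype.card α := by
  have hne : Nonempty α := by
    by_contra h
    rw [not_nonempty_iff] at h
    simp at hsum
  obtain ⟨a₀⟩ := hne
  have hnp (a : α) : 0 ≤ n * p a := mul_nonneg n.cast_nonneg (hp a)
  have hn : ∑ a, n * p a = n := by rw [← Finset.mul_sum, hsum, mul_one]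
  have hle : ∑ a, ⌊n * p a⌋₊ ≤ n := by
    have : ((∑ a, ⌊n * p a⌋₊ : ℕ) : ℝ) ≤ n := by
      rw [Nat.cast_sum]
      exact (Finset.sum_le_sum fun a _ => Nat.floor_le (hnp a)).trans_eq hn
    exact_mod_cast this
  have hge : (n : ℝ) ≤ (∑ a, ⌊n * p a⌋₊ : ℕ) + Fintype.card α := by
    have h : ∑ a, n * p a ≤ ∑ a, ((⌊n * p a⌋₊ : ℝ) + 1) :=
      Finset.sum_le_sum fun a _ => (Nat.lt_floor_add_one _).le
    rw [hn, Finset.sum_add_distrib] at h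
    simpa using h
  -- Rounding down loses at most one point per label; the whole deficit goes to the single label
  -- `a₀`.
  obtain ⟨f, hf⟩ := exists_fun_card_fiber_eq (n := n)
    (fun a => ⌊n * p a⌋₊ + if a = a₀ then n - ∑ a, ⌊n * p a⌋₊ else 0) (by
      rw [Finset.sum_add_distrib, Finset.sum_ite_eq' _ a₀]
      simpa using Nat.add_sub_cancel' hle)
  refine ⟨f, fun a => ?_⟩
  rw [hf, Nat.cast_add]
  refine add_le_add (Nat.floor_le (hnp a)) ?_
  split_ifs
  · rw [Nat.cast_sub hle]
    linarith
  · simp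

theorem sum_comp_eq_sum_card_fiber_mul {α ι : Type*} [Fintype α] [DecidableEq α] [Fintype ι]
    (f : ι → α) (g : α → ℝ) :
    ∑ s, g (f s) = ∑ a, (Fintype.card {s // f s = a} : ℝ) * g a := by
  rw [← Finset.sum_fiberwise (g := f)]
  refine Finset.sum_congr rfl fun a _ => ?_
  rw [Finset.sum_congr rfl (g := fun _ => g a) fun s hs => by rw [(Finset.mem_filter.1 hs).2],
    Finset.sum_const, nsmul_eq_mul, Fintype.card_subtype]

/-- If the labels of a finite set have weights `p`, then rounding the weights to multiples of
`1 / n` and ordering the `n` resulting points by each of the labels `u`, `v`, `w` gives a partition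
into triples whose sum is controlled by the cumulative weights. -/
theorem discreteMin_le_of_weights {α : Type*} [Fintype α] {p : α → ℝ} (hp : ∀ a, 0 ≤ p a)
    (hsum : ∑ a, p a = 1) {u v w : α → ℕ} {U V W : α → ℝ}
    (hU : ∀ a, ∑ b with u b ≤ u a, p b ≤ U a) (hV : ∀ a, ∑ b with v b ≤ v a, p b ≤ V a)
    (hW : ∀ a, ∑ b with w b ≤ w a, p b ≤ W a) (n : ℕ) :
    (discreteMin n : ℝ) ≤ ∑ a, (n * p a + Fintype.card α) *
      ((n * U a + Fintype.card α ^ 2) * (n * V a + Fintype.card α ^ 2) *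
        (n * W a + Fintype.card α ^ 2)) := by
  classical
  obtain ⟨f, hf⟩ := exists_fun_card_fiber_le hp hsum n
  have key {u : α → ℕ} {U : α → ℝ} (hU : ∀ a, ∑ b with u b ≤ u a, p b ≤ U a) (a : α) :
      (Fintype.card {r // u (f r) ≤ u a} : ℝ) ≤ n * U a + Fintype.card α ^ 2 := by
    have h : (Fintype.card {r // u (f r) ≤ u a} : ℝ) =
        ∑ r, (fun b => if u b ≤ u a then (1 : ℝ) else 0) (f r) := by
      simp [Fintype.card_subtype]
    rw [h, sum_comp_eq_sum_card_fiber_mul f fun b => if u b ≤ u a then (1 : ℝ) else 0]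
    -- An error of `card α` for each of the `card α` labels produces the square.
    calc _ ≤ ∑ b, ((if u b ≤ u a then n * p b else 0) + Fintype.card α) := by
          refine Finset.sum_le_sum fun b _ => ?_
          split_ifs
          · simpa using hf b
          · simp
      _ = n * (∑ b with u b ≤ u a, p b) + Fintype.card α ^ 2 := by
          rw [Finset.sum_add_distrib, ← Finset.sum_filter, ← Finset.mul_sum]
          simp [sq]
      _ ≤ _ := by gcongr; exact hU a
  have h := discreteMin_le_sum_card (u ∘ f) (v ∘ f) (w ∘ f)
  simp only [Function.comp_apply] at h
  let g (a : α) : ℝ := (Fintype.card {r // u (f r) ≤ u a} : ℝ) *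
    (Fintype.card {r // v (f r) ≤ v a} : ℝ) * (Fintype.card {r // w (f r) ≤ w a} : ℝ)
  calc (discreteMin n : ℝ) ≤ ∑ s, g (f s) := by simp only [g]; exact_mod_cast h
    _ = ∑ a, (Fintype.card {s // f s = a} : ℝ) * g a := sum_comp_eq_sum_card_fiber_mul f g
    _ ≤ _ := by
        refine Finset.sum_le_sum fun a _ => mul_le_mul (hf a) ?_ (by positivity)
          (add_nonneg (mul_nonneg n.cast_nonneg (hp a)) (Nat.cast_nonneg _))
        exact mul_le_mul_of_nonneg (mul_le_mul_of_nonneg (key hU a) (key hV a) (by positivity)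
          ((Nat.cast_nonneg _).trans (key hV a))) (key hW a) (by positivity)
          ((Nat.cast_nonneg _).trans (key hW a))

theorem tendsto_affine_div (c K : ℝ) :
    Tendsto (fun n : ℕ => (n * c + K) / (n : ℝ)) atTop (nhds c) := by
  have h : Tendsto (fun n : ℕ => c + K / (n : ℝ)) atTop (nhds (c + 0)) :=
    tendsto_const_nhds.add (tendsto_const_div_atTop_nhds_zero_nat K)
  rw [add_zero] at h
  refine h.congr' ?_
  filter_upwards [eventually_ne_atTop 0] with n hn
  have : (n : ℝ) ≠ 0 := by exact_mod_cast hn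
  field_simp

/-- The label set is fixed, so the rounding errors vanish after each of the four factors is divided
by `n`. -/
theorem eventually_discreteMin_le_of_weights {α : Type*} [Fintype α] {p : α → ℝ}
    (hp : ∀ a, 0 ≤ p a) (hsum : ∑ a, p a = 1) {u v w : α → ℕ} {U V W : α → ℝ}
    (hU : ∀ a, ∑ b with u b ≤ u a, p b ≤ U a) (hV : ∀ a, ∑ b with v b ≤ v a, p b ≤ V a)
    (hW : ∀ a, ∑ b with w b ≤ w a, p b ≤ W a) {c : ℝ}
    (hc : ∑ a, p a * (U a * V a * W a) < c) :
    ∀ᶠ n : ℕ in atTop, (discreteMin n : ℝ) / (n : ℝ) ^ 4 ≤ c := by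
  have h : Tendsto (fun n : ℕ => ∑ a, (n * p a + Fintype.card α) / (n : ℝ) *
      ((n * U a + Fintype.card α ^ 2) / (n : ℝ) * ((n * V a + Fintype.card α ^ 2) / (n : ℝ)) *
        ((n * W a + Fintype.card α ^ 2) / (n : ℝ)))) atTop
      (nhds (∑ a, p a * (U a * V a * W a))) :=
    tendsto_finsetSum _ fun a _ => (tendsto_affine_div _ _).mul
      (((tendsto_affine_div _ _).mul (tendsto_affine_div _ _)).mul (tendsto_affine_div _ _))
  filter_upwards [h.eventually_lt_const hc] with n hn
  refine le_trans ?_ hn.le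
  calc (discreteMin n : ℝ) / (n : ℝ) ^ 4 ≤ _ :=
        div_le_div_of_nonneg_right (discreteMin_le_of_weights hp hsum hU hV hW n) (by positivity)
    _ = _ := by
        rw [Finset.sum_div]
        refine Finset.sum_congr rfl fun a _ => ?_
        ring

/-! ### Discretising a stochastic measure -/

/-- The index of the interval `[j / m, (j + 1) / m)` which contains `x`. -/
noncomputable def cellIndex (m : ℕ) (x : I) : Fin (m + 1) :=
  ⟨⌊m * (x : ℝ)⌋₊, Nat.lt_succ_of_le (Nat.floor_le_of_le
    (mul_le_of_le_one_right m.cast_nonneg x.2.2))⟩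

theorem measurable_cellIndex (m : ℕ) : Measurable (cellIndex m) := by
  refine measurable_to_countable' fun j => ?_
  have : cellIndex m ⁻¹' {j} = (fun x : I => ⌊m * (x : ℝ)⌋₊) ⁻¹' {(j : ℕ)} := by
    ext x
    simp [cellIndex, Fin.ext_iff]
  rw [this]
  exact (Nat.measurable_floor.comp (by fun_prop)) (measurableSet_singleton _)

theorem cellIndex_add_one_div_le {m : ℕ} (hm : m ≠ 0) (x : I) :
    ((cellIndex m x : ℕ) + 1 : ℝ) / m ≤ x + (m : ℝ)⁻¹ := by
  have hm' : (0 : ℝ) < m := by positivity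
  have h : ((cellIndex m x : ℕ) : ℝ) ≤ m * x := Nat.floor_le (mul_nonneg hm'.le x.2.1)
  rw [div_le_iff₀ hm', add_mul, inv_mul_cancel₀ hm'.ne']
  linarith

theorem volume_real_cellIndex_le {m : ℕ} (hm : m ≠ 0) (j : ℕ) :
    (volume : Measure I).real {x | (cellIndex m x : ℕ) ≤ j} ≤ ((j : ℝ) + 1) / m := by
  have hm' : (0 : ℝ) < m := by positivity
  have hsub : Subtype.val '' {x : I | (cellIndex m x : ℕ) ≤ j} ⊆
      Set.Icc (0 : ℝ) (((j : ℝ) + 1) / m) := by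
    rintro _ ⟨x, hx, rfl⟩
    refine ⟨x.2.1, ?_⟩
    have h1 : (m * x : ℝ) < ⌊m * (x : ℝ)⌋₊ + 1 := Nat.lt_floor_add_one _
    have h2 : (⌊m * (x : ℝ)⌋₊ : ℝ) ≤ j := by exact_mod_cast hx
    rw [le_div_iff₀ hm']
    linarith
  rw [measureReal_def, unitInterval.volume_apply]
  refine ENNReal.toReal_le_of_le_ofReal (by positivity) ((measure_mono hsub).trans ?_)
  simp

/-- The cumulative weight is the marginal mass of an initial segment of `[0,1]`, which the uniform
marginal bounds by its length. -/
theorem sum_cellIndex_le {m : ℕ} (hm : m ≠ 0) {μ : Measure (I × I × I)} [IsFiniteMeasure μ]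
    {α : Type*} [Fintype α] [MeasurableSpace α] [MeasurableSingletonClass α]
    {φ : I × I × I → α} (hφ : Measurable φ) {u : α → ℕ} {π : I × I × I → I} (hπ : Measurable π)
    (hu : ∀ q, u (φ q) = cellIndex m (π q)) (hμ : μ.map π = volume) (a : α) :
    ∑ b with u b ≤ u a, (μ.map φ).real {b} ≤ ((u a : ℝ) + 1) / m := by
  refine le_trans (le_of_eq ?_) (volume_real_cellIndex_le hm (u a))
  have hs : MeasurableSet {x | (cellIndex m x : ℕ) ≤ u a} :=
    measurableSet_le (measurable_from_top.comp (measurable_cellIndex m)) measurable_const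
  rw [sum_measureReal_singleton, ← hμ, map_measureReal_apply hπ hs,
    map_measureReal_apply hφ (Finset.measurableSet _)]
  congr 1
  ext q
  simp [hu]

theorem eventually_discreteMin_le {m : ℕ} (hm : m ≠ 0) {μ : Measure (I × I × I)}
    (hμ : μ ∈ stochasticMeasures) :
    ∀ᶠ n : ℕ in atTop, (discreteMin n : ℝ) / (n : ℝ) ^ 4 ≤ primalValue μ + 8 * (m : ℝ)⁻¹ := by
  have := isProbabilityMeasure_of_mem_stochasticMeasures hμ
  have hm' : (0 : ℝ) < (m : ℝ)⁻¹ := by positivity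
  have hm1 : (m : ℝ)⁻¹ ≤ 1 := Nat.cast_inv_le_one m
  let φ (q : I × I × I) : Fin (m + 1) × Fin (m + 1) × Fin (m + 1) :=
    (cellIndex m q.1, cellIndex m q.2.1, cellIndex m q.2.2)
  have hφ : Measurable φ :=
    ((measurable_cellIndex m).comp measurable_fst).prodMk
      (((measurable_cellIndex m).comp (measurable_fst.comp measurable_snd)).prodMk
        ((measurable_cellIndex m).comp (measurable_snd.comp measurable_snd)))
  have := Measure.isProbabilityMeasure_map (μ := μ) hφ.aemeasurable
  refine eventually_discreteMin_le_of_weights (p := fun a => (μ.map φ).real {a})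
    (fun _ => measureReal_nonneg) (by simp)
    (sum_cellIndex_le hm hφ (u := fun a => a.1) measurable_fst (fun _ => rfl) hμ.1)
    (sum_cellIndex_le hm hφ (u := fun a => a.2.1) (measurable_fst.comp measurable_snd)
      (fun _ => rfl) hμ.2.1)
    (sum_cellIndex_le hm hφ (u := fun a => a.2.2) (measurable_snd.comp measurable_snd)
      (fun _ => rfl) hμ.2.2) ?_
  have e := integral_fintype (μ := μ.map φ) (f := fun a => (((a.1 : ℕ) : ℝ) + 1) / m *
    ((((a.2.1 : ℕ) : ℝ) + 1) / m) * ((((a.2.2 : ℕ) : ℝ) + 1) / m)) .of_finite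
  simp only [smul_eq_mul] at e
  rw [← e, integral_map hφ.aemeasurable .of_discrete]
  have hint : Integrable (fun q : I × I × I => (q.1 : ℝ) * q.2.1 * q.2.2) μ :=
    integrable_of_continuous_of_compactSpace continuous_cost
  have h7 : (∫ q, ((q.1 : ℝ) * q.2.1 * q.2.2 + 7 * (m : ℝ)⁻¹) ∂μ) =
      primalValue μ + 7 * (m : ℝ)⁻¹ := by
    rw [integral_add hint (integrable_const _)]
    simp [primalValue]
  -- Rounding up to cell edges costs at most `7/m`; the eighth `1/m` gives the strict inequality
  -- required.
  refine lt_of_le_of_lt ?_ (show primalValue μ + 7 * (m : ℝ)⁻¹ < _ by linarith)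
  rw [← h7]
  refine integral_mono_of_nonneg (Eventually.of_forall fun q => by positivity)
    (hint.add (integrable_const _)) (Eventually.of_forall fun q => ?_)
  have h1 := cellIndex_add_one_div_le hm q.1
  have h2 := cellIndex_add_one_div_le hm q.2.1
  have h3 := cellIndex_add_one_div_le hm q.2.2
  have x0 := q.1.2.1
  have y0 := q.2.1.2.1
  have z0 := q.2.2.2.1
  have x1 := q.1.2.2
  have y1 := q.2.1.2.2
  have z1 := q.2.2.2.2
  calc _ ≤ ((q.1 : ℝ) + (m : ℝ)⁻¹) * (q.2.1 + (m : ℝ)⁻¹) * (q.2.2 + (m : ℝ)⁻¹) := by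
        dsimp only [φ]
        gcongr
    -- Besides `xyz`, the expansion has seven monomials, each containing `d = 1/m` and other factors
    -- at most `1`.
    _ ≤ (q.1 : ℝ) * q.2.1 * q.2.2 + 7 * (m : ℝ)⁻¹ := by
        generalize (m : ℝ)⁻¹ = d at *
        generalize (q.1 : ℝ) = x at *
        generalize (q.2.1 : ℝ) = y at *
        generalize (q.2.2 : ℝ) = z at *
        have a1 : x * y * d ≤ d := mul_le_of_le_one_left hm'.le (mul_le_one₀ x1 y0 y1)
        have a2 : x * z * d ≤ d := mul_le_of_le_one_left hm'.le (mul_le_one₀ x1 z0 z1)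
        have a3 : y * z * d ≤ d := mul_le_of_le_one_left hm'.le (mul_le_one₀ y1 z0 z1)
        have a4 : x * d * d ≤ d := mul_le_of_le_one_left hm'.le (mul_le_one₀ x1 hm'.le hm1)
        have a5 : y * d * d ≤ d := mul_le_of_le_one_left hm'.le (mul_le_one₀ y1 hm'.le hm1)
        have a6 : z * d * d ≤ d := mul_le_of_le_one_left hm'.le (mul_le_one₀ z1 hm'.le hm1)
        have a7 : d * d * d ≤ d := mul_le_of_le_one_left hm'.le (mul_le_one₀ hm1 hm'.le hm1)
        linarith

theorem tendsto_discreteMin_div :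
    Tendsto (fun n : ℕ => (discreteMin n : ℝ) / (n : ℝ) ^ 4) atTop (nhds primalOptimum) := by
  obtain ⟨μ, hμ, h⟩ := isLeast_primalOptimum.1
  refine tendsto_order.2 ⟨fun c hc => ?_, fun c hc => ?_⟩
  · filter_upwards [eventually_ne_atTop 0] with n hn
    exact hc.trans_le (primalOptimum_le_discreteMin hn)
  · have ht : Tendsto (fun m : ℕ => primalOptimum + 8 * (m : ℝ)⁻¹) atTop
        (nhds (primalOptimum + 8 * 0)) :=
      tendsto_const_nhds.add (tendsto_inv_atTop_nhds_zero_nat.const_mul 8)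
    rw [mul_zero, add_zero] at ht
    -- The mesh is fixed before `n` tends to infinity.
    obtain ⟨m, hmc, hm⟩ := ((ht.eventually_lt_const hc).and (eventually_ne_atTop 0)).exists
    filter_upwards [eventually_discreteMin_le hm hμ] with n hn
    rw [h] at hn
    exact hn.trans_lt hmc

theorem mainTheorem5 :
    IsLeast (primalValue '' stochasticMeasures) primalOptimum ∧
    (fun n : ℕ => (discreteMin n : ℝ)) ~[atTop] (fun n : ℕ => primalOptimum * (n : ℝ) ^ 4) := by
  refine ⟨isLeast_primalOptimum, ?_⟩
  have hC := primalOptimum_pos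
  refine (isEquivalent_iff_tendsto_one ?_).2 ?_
  · filter_upwards [eventually_ne_atTop 0] with n hn
    have : (n : ℝ) ≠ 0 := by exact_mod_cast hn
    positivity
  · have h := tendsto_discreteMin_div.div_const primalOptimum
    rw [div_self hC.ne'] at h
    refine h.congr fun n => ?_
    rw [Pi.div_apply, div_div, mul_comm]
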